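/- Let $(X,d)$ be a separable metric space with a Radon measure $\mu$ (a Borel measure that is finite on compact sets, outer regular on Borel sets, and inner regular by compact sets on open sets). **Notation.** For a Lipschitz function $f$ with Lipschitz constant $L(f)$ put $$\operatorname{Lip}[f](x)=\limsup_{r\to0}\ \sup_{y\in\bar B(x,r)}\frac{|f(y)-f(x)|}{r}.$$ $\operatorname{Lip}(X)$ is the set of real-valued Lipschitz functions on $X$, and $\operatorname{Lip}_b(X)$ is the algebra of bounded ones, with norm $\max\{L(f),\|f\|_\infty\}$. A sequence converges weak-$*$ in $\operatorname{Lip}_b(X)$, $f_k\overset{*}{\rightharpoonup}f$, if it is norm-bounded and converges pointwise to $f$. A *derivation* is a bounded linear operator $\delta:\operatorname{Lip}_b(X)\to L^\infty(X;\mu)$ with $\delta(fg)=f\,\delta g+g\,\delta f$ such that $f_k\overset{*}{\rightharpoonup}f$ implies $\delta f_k\overset{*}{\rightharpoonup}\delta f$ in $L^\infty(X;\mu)=L^1(X;\mu)^*$. By locality, $\delta$ extends to unbounded Lipschitz functions: $\delta f=\delta(\max(-n,\min(n,f)))$ a.e. on $\{|f|<n\}$ for each $n\in\mathbb N$. $\Upsilon(X,\mu)$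 is the $L^\infty(X;\mu)$-module of all derivations. A finite family $(\delta_i)_{i=1}^m$ is *linearly independent* if $\sum_i\lambda_i\delta_i=0$ with $\lambda_i\in L^\infty(X;\mu)$ forces every $\lambda_i=0$. It is a *basis* of $\Upsilon(X,\mu)$ if it is linearly independent and every family of $m+1$ derivations is linearly dependent. Functions $g_1,\dots,g_N\in\operatorname{Lip}(X)$ *generate* $\operatorname{Lip}_b(X)$ if for every ball $B\subset X$ and every $f\in\operatorname{Lip}_b(X)$ there are real polynomials $p_n$ in $N$ variables with $p_n(g_1,\dots,g_N)|_B\overset{*}{\rightharpoonup}f|_B$ in $\operatorname{Lip}_b(B)$. A $\mu$-measurable set $Y\subset X$ with $\mu(Y)>0$ is a *chart* of dimension $n\ge0$ with coordinates a Lipschitz map $\xi:X\to\mathbb R^n$ if for every $f\in\operatorname{Lip}(X)$ there is a unique $Df\in L^\infty(Y;\mathbb R^n)$ with $\operatorname{Lip}[f-Df(x)\cdot\xi](x)=0$ for $\mu$-a.e. $x\in Y$. A *measurable differentiable structure* on $(X,d,\mu)$ is a sequence of charts $X_m$ (with coordinates) of uniformly bounded dimensions $n(m)$ such that $\mu(X\setminus\bigcup_mX_m)=0$.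 It is *non-degenerate* if $n(m)\ge1$ for some $m$. **Theorem.** Suppose that $\mu$ has the Lebesgue differentiation property: for every non-negative $f\in L^1(X,\mu)$, $$\frac1{\mu(B(x,r))}\int_{B(x,r)}f\,d\mu\to f(x)\quad\text{as } r\to0,\ \text{ for $\mu$-a.e. } x\in X.$$ Suppose further that 1. $\Upsilon(X,\mu)$ has a basis $\mathbf d=(\delta_j)_{j=1}^M$ for some $M>0$; 2. $\operatorname{Lip}_b(X)$ is generated by some $g_1,\dots,g_N\in\operatorname{Lip}(X)$ with $M\le N<\infty$; 3. the Lip-derivation inequality holds for $\mathbf d$: there is $K\ge1$ such that for every $f\in\operatorname{Lip}(X)$, $$K^{-1}|\mathbf df(x)|\le\operatorname{Lip}[f](x)\le K|\mathbf df(x)|\quad\text{for $\mu$-a.e. }x\in X,$$ where $\mathbf df=(\delta_1f,\dots,\delta_Mf)$. Then $(X,d,\mu)$ supports a non-degenerate measurable differentiable structure. -/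

import Mathlib

open MeasureTheory Filter Topology Metric Set
open scoped ENNReal NNReal

noncomputable section

/-- `f` is a Lipschitz function on `X`, with values in the metric space `Y`. -/
def IsLip {X Y : Type*} [PseudoMetricSpace X] [PseudoMetricSpace Y] (f : X → Y) : Prop :=
  ∃ K : ℝ≥0, LipschitzWith K f

/-- The algebra `Lip_b(X)` of bounded real-valued Lipschitz functions. -/
def LipB (X : Type*) [PseudoMetricSpace X] : Subalgebra ℝ (X → ℝ) where
  carrier := {f | IsLip f ∧ ∃ C : ℝ, ∀ x, |f x| ≤ C}
  mul_mem' := by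
    rintro f g ⟨⟨K, hK⟩, C, hC⟩ ⟨⟨L, hL⟩, D, hD⟩
    refine ⟨⟨C.toNNReal * L + D.toNNReal * K, ?_⟩, C.toNNReal * D.toNNReal, fun x => ?_⟩
    · refine LipschitzWith.of_dist_le_mul fun x y => ?_
      have h1 := hK.dist_le_mul x y
      have h2 := hL.dist_le_mul x y
      rw [Real.dist_eq] at h1 h2
      rw [Real.dist_eq]
      have h3 : |f x| ≤ C.toNNReal := (hC x).trans (Real.le_coe_toNNReal C)
      have h4 : |g y| ≤ D.toNNReal := (hD y).trans (Real.le_coe_toNNReal D)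
      have h5 : (f * g) x - (f * g) y = f x * (g x - g y) + g y * (f x - f y) := by
        simp only [Pi.mul_apply]; ring
      rw [h5]
      refine (abs_add_le _ _).trans ?_
      rw [abs_mul, abs_mul]
      have h6 : |f x| * |g x - g y| ≤ C.toNNReal * (L * dist x y) := by gcongr
      have h7 : |g y| * |f x - f y| ≤ D.toNNReal * (K * dist x y) := by gcongr
      push_cast
      linarith
    · rw [Pi.mul_apply, abs_mul]
      exact mul_le_mul ((hC x).trans (Real.le_coe_toNNReal C))
        ((hD x).trans (Real.le_coe_toNNReal D)) (abs_nonneg _) (NNReal.coe_nonneg _)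
  add_mem' := by
    rintro f g ⟨⟨K, hK⟩, C, hC⟩ ⟨⟨L, hL⟩, D, hD⟩
    exact ⟨⟨K + L, hK.add hL⟩, C + D, fun x =>
      (abs_add_le _ _).trans (add_le_add (hC x) (hD x))⟩
  algebraMap_mem' := by
    intro c
    exact ⟨⟨0, LipschitzWith.const c⟩, |c|, fun _ => le_rfl⟩

/-- The norm `max {L(f), ‖f‖_∞}` of `Lip_b(X)`, where `L(f)` is the Lipschitz constant.
(Pairs with `x = y` contribute `0`; both suprema are finite on `Lip_b(X)`.) -/
def lipNorm {X : Type*} [PseudoMetricSpace X] (f : LipB X) : ℝ :=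
  max (⨆ p : X × X, |f.1 p.1 - f.1 p.2| / dist p.1 p.2) (⨆ x : X, |f.1 x|)

/-- Weak-* convergence of sequences in the dual Banach space `Lip_b(X)`:
norm-boundedness together with pointwise convergence. -/
def LipWeakStar {X : Type*} [PseudoMetricSpace X] (u : ℕ → LipB X) (f : LipB X) : Prop :=
  (∃ C : ℝ, ∀ k, lipNorm (u k) ≤ C) ∧
    ∀ x, Tendsto (fun k => (u k).1 x) atTop (𝓝 (f.1 x))

/-- The restriction of a bounded Lipschitz function to a subset. -/
def lipRestrict {X : Type*} [PseudoMetricSpace X] (f : LipB X) (B : Set X) : LipB B :=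
  ⟨fun y => f.1 y, by
    obtain ⟨⟨K, hK⟩, C, hC⟩ := f.2
    exact ⟨⟨K, fun x y => hK x y⟩, C, fun x => hC x⟩⟩

/-- The truncation `max (-n) (min n f)` of a Lipschitz function `f`. -/
def lipTrunc {X : Type*} [PseudoMetricSpace X] (f : X → ℝ) (hf : IsLip f) (n : ℕ) : LipB X :=
  ⟨fun x => max (-(n : ℝ)) (min (n : ℝ) (f x)), by
    obtain ⟨K, hK⟩ := hf
    refine ⟨⟨K, (hK.const_min _).const_max _⟩, n, fun x => abs_le.2 ⟨le_max_left _ _, ?_⟩⟩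
    refine max_le ?_ (min_le_left _ _)
    have : (0 : ℝ) ≤ n := Nat.cast_nonneg n
    linarith⟩

/-- The functions `g 1, …, g N` are Lipschitz and generate `Lip_b(X)`: on every ball `B`, every
`f ∈ Lip_b(X)` is the weak-* limit in `Lip_b(B)` of a sequence of polynomials in `g 1, …, g N`.
(`g` maps `B` to a bounded set, on which every polynomial is bounded and Lipschitz.) -/
def Generates {X : Type*} [PseudoMetricSpace X] {N : ℕ} (g : Fin N → X → ℝ) : Prop :=
  (∀ i, IsLip (g i)) ∧
    ∀ (x₀ : X) (r : ℝ), 0 < r → ∀ f : LipB X,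
      ∃ (p : ℕ → MvPolynomial (Fin N) ℝ) (u : ℕ → LipB (ball x₀ r)),
        (∀ n y, (u n).1 y = MvPolynomial.eval (fun i => g i y) (p n)) ∧
          LipWeakStar u (lipRestrict f (ball x₀ r))

/-- The pointwise Lipschitz constant
`Lip[f](x) = limsup_{r → 0} sup_{y ∈ closedBall x r} |f y - f x| / r`. -/
def pointLip {X : Type*} [PseudoMetricSpace X] (f : X → ℝ) (x : X) : ℝ≥0∞ :=
  limsup (fun r : ℝ => ⨆ y ∈ closedBall x r, ENNReal.ofReal (|f y - f x| / r)) (𝓝[>] 0)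

/-- A (metric) derivation in the sense of Weaver: a bounded linear operator from `Lip_b(X)` to
`L^∞(X; μ)` which satisfies the Leibniz rule and is weak-* to weak-* continuous. -/
structure MetricDerivation {X : Type*} [PseudoMetricSpace X] [MeasurableSpace X]
    (μ : Measure X) where
  toFun : LipB X →ₗ[ℝ] Lp ℝ ∞ μ
  bounded : ∃ C : ℝ, ∀ f, ‖toFun f‖ ≤ C * lipNorm f
  leibniz : ∀ f g : LipB X, ∀ᵐ x ∂μ,
    toFun (f * g) x = f.1 x * toFun g x + g.1 x * toFun f x
  weakCont : ∀ (u : ℕ → LipB X) (f : LipB X), LipWeakStar u f →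
    ∀ φ : X → ℝ, Integrable φ μ →
      Tendsto (fun k => ∫ x, φ x * toFun (u k) x ∂μ) atTop (𝓝 (∫ x, φ x * toFun f x ∂μ))

/-- The action of a derivation on an arbitrary, possibly unbounded, Lipschitz function `f`. On the
set `{n ≤ |f| < n + 1}` it is the derivation of the truncation of `f` at height `n + 1`, which
agrees with `f` on the open set `{|f| < n + 1}`. -/
def MetricDerivation.ext {X : Type*} [PseudoMetricSpace X] [MeasurableSpace X] {μ : Measure X}
    (δ : MetricDerivation μ) (f : X → ℝ) (hf : IsLip f) (x : X) : ℝ :=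
  δ.toFun (lipTrunc f hf (⌊|f x|⌋₊ + 1)) x

/-- Linear independence over `L^∞(X; μ)` of a finite family of derivations. -/
def DerivLinIndep {X : Type*} [PseudoMetricSpace X] [MeasurableSpace X] {μ : Measure X} {m : ℕ}
    (δ : Fin m → MetricDerivation μ) : Prop :=
  ∀ c : Fin m → Lp ℝ ∞ μ,
    (∀ f : LipB X, ∀ᵐ x ∂μ, ∑ i, c i x * (δ i).toFun f x = 0) → ∀ i, c i = 0

/-- The module of derivations of `(X, μ)` has rank `m`. -/
def DerivHasRank {X : Type*} [PseudoMetricSpace X] [MeasurableSpace X] (μ : Measure X)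
    (m : ℕ) : Prop :=
  (∃ δ : Fin m → MetricDerivation μ, DerivLinIndep δ) ∧
    ∀ δ : Fin (m + 1) → MetricDerivation μ, ¬ DerivLinIndep δ

/-- The family `δ` is a basis of the module of derivations of `(X, μ)`. -/
def IsDerivBasis {X : Type*} [PseudoMetricSpace X] [MeasurableSpace X] {μ : Measure X} {m : ℕ}
    (δ : Fin m → MetricDerivation μ) : Prop :=
  DerivLinIndep δ ∧ DerivHasRank μ m

/-- The vector `(δ_1 f (x), …, δ_m f (x))`. -/
def derivVec {X : Type*} [PseudoMetricSpace X] [MeasurableSpace X] {μ : Measure X} {m : ℕ}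
    (δ : Fin m → MetricDerivation μ) (f : X → ℝ) (hf : IsLip f) (x : X) :
    EuclideanSpace ℝ (Fin m) :=
  WithLp.toLp 2 fun i => (δ i).ext f hf x

/-- The (two-sided) Lip-derivation inequality with constant `K`, for all Lipschitz functions. -/
def LipDerivIneq {X : Type*} [PseudoMetricSpace X] [MeasurableSpace X] {μ : Measure X} {m : ℕ}
    (δ : Fin m → MetricDerivation μ) (K : ℝ) : Prop :=
  ∀ (f : X → ℝ) (hf : IsLip f), ∀ᵐ x ∂μ,
    ENNReal.ofReal (K⁻¹ * ‖derivVec δ f hf x‖) ≤ pointLip f x ∧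
      pointLip f x ≤ ENNReal.ofReal (K * ‖derivVec δ f hf x‖)

/-- The Lebesgue differentiation property of a measure. -/
def LebesgueDiffProp {X : Type*} [PseudoMetricSpace X] [MeasurableSpace X]
    (μ : Measure X) : Prop :=
  ∀ f : X → ℝ, Integrable f μ → (∀ x, 0 ≤ f x) →
    ∀ᵐ x ∂μ, Tendsto (fun r => ⨍ y in ball x r, f y ∂μ) (𝓝[>] 0) (𝓝 (f x))

/-- `Y` is a chart of differentiability with coordinates `ξ`, of chart dimension `n`. -/
structure IsDiffChart {X : Type*} [PseudoMetricSpace X] [MeasurableSpace X] (μ : Measure X)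
    (Y : Set X) (n : ℕ) (ξ : X → EuclideanSpace ℝ (Fin n)) : Prop where
  measurable : NullMeasurableSet Y μ
  pos : 0 < μ Y
  lip : IsLip ξ
  differential : ∀ f : X → ℝ, IsLip f →
    ∃! D : Lp (EuclideanSpace ℝ (Fin n)) ∞ (μ.restrict Y),
      ∀ᵐ x ∂(μ.restrict Y), pointLip (fun y => f y - inner ℝ (D x) (ξ y)) x = 0

/-- A (strong) measurable differentiable structure on `(X, μ)`. -/
structure MeasurableDiffStructure {X : Type*} [PseudoMetricSpace X] [MeasurableSpace X]
    (μ : Measure X) where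
  chart : ℕ → Set X
  dim : ℕ → ℕ
  coord : ∀ m, X → EuclideanSpace ℝ (Fin (dim m))
  isChart : ∀ m, IsDiffChart μ (chart m) (dim m) (coord m)
  cover : μ (⋃ m, chart m)ᶜ = 0
  dimBound : ∃ N : ℕ, ∀ m, dim m ≤ N

/-- Some chart has positive dimension. -/
def MeasurableDiffStructure.Nondegenerate {X : Type*} [PseudoMetricSpace X] [MeasurableSpace X]
    {μ : Measure X} (S : MeasurableDiffStructure μ) : Prop :=
  ∃ m, 1 ≤ S.dim m

end

/-! For a choice `I` of `M` generators let `A(x)` be the matrix with entries `δ_j g_{I(i)}(x)`.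
Where `det A(x) ≠ 0`, the vector `v = df(x) A(x)⁻¹` is the only one for which the derivations
annihilate `f - v · g_I` at `x`. By the Lip-derivation inequality this is the same as `Lip[f - v ·
g_I](x) = 0`, the upper bound giving existence of the differential and the lower one uniqueness. So
`g_I` are coordinates on every positive-measure set where `A` is invertible with bounded inverse
(`LipDerivIneq.isDiffChart`), and there are countably many such sets, indexed by `I` and an integer
bound.

Two points need work. First, these sets must cover almost everything. If all `M × M` minors vanished
on a set of positive measure, a measurable choice of kernel vectors would give a non-trivial bounded
combination of the `δ_j` annihilating every generator. By the Leibniz rule it annihilates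
polynomials in them, and by weak-* continuity all of `Lip_b` (`derivComb_ae_eq_zero`), against
linear independence; this is `DerivLinIndep.ae_exists_det_ne_zero`.

Secondly, the Lip-derivation inequality has an exceptional null set depending on the function, while
`v` depends on `x`. Both sides are continuous in `v`, so a countable dense set of vectors gives one
null set for all `v` (`LipDerivIneq.ae_forall_sub_inner`). -/

/-! ### Lipschitz functions -/

section LipschitzFunctions

variable {X : Type*} [PseudoMetricSpace X]

lemma IsLip.continuous {f : X → ℝ} (hf : IsLip f) : Continuous f :=
  hf.choose_spec.continuous

lemma IsLip.add_const_mul {f g : X → ℝ} (hf : IsLip f) (hg : IsLip g) (c : ℝ) :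
    IsLip fun x => f x + c * g x := by
  obtain ⟨K, hK⟩ := hf
  obtain ⟨L, hL⟩ := hg
  refine ⟨K + ‖c‖₊ * L, hK.add ?_⟩
  refine LipschitzWith.of_dist_le_mul fun x y => ?_
  have h := hL.dist_le_mul x y
  rw [Real.dist_eq] at h ⊢
  rw [← mul_sub, abs_mul, NNReal.coe_mul, coe_nnnorm, Real.norm_eq_abs, mul_assoc]
  gcongr

lemma IsLip.add_sum {ι : Type*} {f : X → ℝ} {g : ι → X → ℝ} (hf : IsLip f)
    (hg : ∀ i, IsLip (g i)) (c : ι → ℝ) (s : Finset ι) :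
    IsLip fun x => f x + ∑ i ∈ s, c i * g i x := by
  classical
  induction s using Finset.induction_on with
  | empty => simpa using hf
  | insert a s ha ih =>
    convert ih.add_const_mul (hg a) (c a) using 2
    rw [Finset.sum_insert ha]; ring

lemma LipB.abs_le_lipNorm (u : LipB X) (x : X) : |u.1 x| ≤ lipNorm u := by
  obtain ⟨-, C, hC⟩ := u.2
  refine le_trans ?_ (le_max_right _ _)
  exact le_ciSup (f := fun x => |u.1 x|) ⟨C, by rintro _ ⟨y, rfl⟩; exact hC y⟩ x

lemma LipB.abs_sub_le_lipNorm (u : LipB X) (x y : X) :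
    |u.1 x - u.1 y| ≤ lipNorm u * dist x y := by
  obtain ⟨⟨K, hK⟩, -⟩ := u.2
  have key : ∀ p : X × X, |u.1 p.1 - u.1 p.2| ≤ K * dist p.1 p.2 := fun p => by
    simpa [Real.dist_eq] using hK.dist_le_mul p.1 p.2
  have h : |u.1 x - u.1 y| / dist x y ≤ lipNorm u := by
    refine le_trans ?_ (le_max_left _ _)
    refine le_ciSup (f := fun p : X × X => |u.1 p.1 - u.1 p.2| / dist p.1 p.2)
      ⟨K, ?_⟩ (x, y)
    rintro _ ⟨p, rfl⟩
    exact div_le_of_le_mul₀ dist_nonneg K.2 (key p)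
  -- In a pseudometric distinct points may be at distance `0`; such pairs contribute the value `0`
  -- to the supremum, so they need the Lipschitz bound itself.
  rcases eq_or_lt_of_le (dist_nonneg : 0 ≤ dist x y) with h0 | h0
  · have := key (x, y)
    simp only [← h0, mul_zero] at this ⊢
    exact this
  · exact (div_le_iff₀ h0).1 h

lemma lipNorm_le {u : LipB X} {C : ℝ} (hC : 0 ≤ C)
    (h₁ : ∀ x y, |u.1 x - u.1 y| ≤ C * dist x y) (h₂ : ∀ x, |u.1 x| ≤ C) : lipNorm u ≤ C := by
  refine max_le (Real.iSup_le (fun p => ?_) hC) (Real.iSup_le h₂ hC)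
  exact div_le_of_le_mul₀ dist_nonneg hC (h₁ p.1 p.2)

lemma lipTrunc_apply_of_abs_le {f : X → ℝ} (hf : IsLip f) {n : ℕ} {x : X} (hx : |f x| ≤ n) :
    (lipTrunc f hf n).1 x = f x := by
  obtain ⟨h₁, h₂⟩ := abs_le.1 hx
  change max (-(n : ℝ)) (min (n : ℝ) (f x)) = f x
  rw [min_eq_right h₂, max_eq_right h₁]

lemma exists_cutoff {U : Set X} (hU : IsOpen U) :
    ∃ χ : LipB X, (∀ x, |χ.1 x| ≤ 1) ∧ (∀ x y, |χ.1 x - χ.1 y| ≤ dist x y) ∧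
      ∀ x, χ.1 x = 0 ↔ x ∉ U := by
  -- The distance to the empty set has the default value `0`, so `U = X` needs the constant cutoff
  -- `1`.
  rcases Uᶜ.eq_empty_or_nonempty with hc | hc
  · refine ⟨1, fun x => ?_, fun x y => ?_, fun x => ?_⟩
    · change |(1 : ℝ)| ≤ 1
      simp
    · change |(1 : ℝ) - 1| ≤ _
      simp
    · change (1 : ℝ) = 0 ↔ _
      simp [compl_empty_iff.1 hc]
  · have hlip := (lipschitz_infDist_pt Uᶜ).const_min 1
    have hle : ∀ x, |min 1 (infDist x Uᶜ)| ≤ 1 := fun x => by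
      rw [abs_of_nonneg (le_min zero_le_one infDist_nonneg)]
      exact min_le_left _ _
    refine ⟨⟨fun x => min 1 (infDist x Uᶜ), ⟨1, hlip⟩, 1, hle⟩, hle, fun x y => ?_, fun x => ?_⟩
    · have := hlip.dist_le_mul x y
      rwa [NNReal.coe_one, one_mul, Real.dist_eq] at this
    · change min 1 (infDist x Uᶜ) = 0 ↔ x ∈ Uᶜ
      rw [hU.isClosed_compl.mem_iff_infDist_zero hc]
      refine ⟨fun h => ?_, fun h => by simp [h]⟩
      rcases min_choice 1 (infDist x Uᶜ) with h' | h' <;> rw [h'] at h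
      · exact absurd h one_ne_zero
      · exact h

end LipschitzFunctions

/-! ### Locality of derivations -/

namespace MetricDerivation

variable {X : Type*} [PseudoMetricSpace X] [MeasurableSpace X] {μ : Measure X}

lemma toFun_zero_ae (δ : MetricDerivation μ) : ∀ᵐ x ∂μ, δ.toFun 0 x = 0 := by
  rw [map_zero]
  exact Lp.coeFn_zero ℝ ∞ μ

lemma toFun_add_smul_ae (δ : MetricDerivation μ) (f g : LipB X) (c : ℝ) :
    ∀ᵐ x ∂μ, δ.toFun (f + c • g) x = δ.toFun f x + c * δ.toFun g x := by
  rw [map_add, map_smul]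
  filter_upwards [Lp.coeFn_add (δ.toFun f) (c • δ.toFun g), Lp.coeFn_smul c (δ.toFun g)]
    with x h₁ h₂
  rw [h₁, Pi.add_apply, h₂, Pi.smul_apply, smul_eq_mul]

/-- With a cutoff `χ` of `U` the product `χ h` is zero, so the Leibniz rule reads `0 = χ δh + h δχ`;
on `U` the last term vanishes and `χ ≠ 0`. -/
lemma ae_eq_zero_of_forall_mem_eq_zero (δ : MetricDerivation μ) {h : LipB X} {U : Set X}
    (hU : IsOpen U) (h0 : ∀ x ∈ U, h.1 x = 0) : ∀ᵐ x ∂μ, x ∈ U → δ.toFun h x = 0 := by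
  obtain ⟨χ, -, -, hχ⟩ := exists_cutoff hU
  have hprod : χ * h = 0 := Subtype.ext <| funext fun x => by
    change χ.1 x * h.1 x = 0
    by_cases hx : x ∈ U
    · rw [h0 x hx, mul_zero]
    · rw [(hχ x).2 hx, zero_mul]
  filter_upwards [δ.leibniz χ h, δ.toFun_zero_ae] with x hL hz hx
  rw [hprod, hz, h0 x hx, zero_mul, add_zero] at hL
  exact (mul_eq_zero.1 hL.symm).resolve_left fun h' => (hχ x).1 h' hx

lemma ae_eq_of_eqOn (δ : MetricDerivation μ) {f g : LipB X} {U : Set X}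
    (hU : IsOpen U) (h : ∀ x ∈ U, f.1 x = g.1 x) :
    ∀ᵐ x ∂μ, x ∈ U → δ.toFun f x = δ.toFun g x := by
  have h0 : ∀ x ∈ U, (f + (-1 : ℝ) • g).1 x = 0 := fun x hx => by
    change f.1 x + (-1 : ℝ) * g.1 x = 0
    rw [h x hx]; ring
  filter_upwards [δ.ae_eq_zero_of_forall_mem_eq_zero hU h0, δ.toFun_add_smul_ae f g (-1)]
    with x h₁ h₂ hx
  have := h₁ hx
  rw [h₂] at this
  linarith

/-- Locality, applied to the countably many pairs of truncation heights. It allows several functions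
to be truncated at one common height. -/
lemma ext_ae_eq_toFun (δ : MetricDerivation μ) {f : X → ℝ} (hf : IsLip f) :
    ∀ᵐ x ∂μ, ∀ n : ℕ, |f x| < n → δ.ext f hf x = δ.toFun (lipTrunc f hf n) x := by
  have key : ∀ᵐ x ∂μ, ∀ m n : ℕ, |f x| < m ∧ |f x| < n →
      δ.toFun (lipTrunc f hf m) x = δ.toFun (lipTrunc f hf n) x := by
    refine ae_all_iff.2 fun m => ae_all_iff.2 fun n => ?_
    refine δ.ae_eq_of_eqOn (U := {x | |f x| < m ∧ |f x| < n}) ?_ fun x hx => ?_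
    · exact (isOpen_lt hf.continuous.abs continuous_const).inter
        (isOpen_lt hf.continuous.abs continuous_const)
    · rw [lipTrunc_apply_of_abs_le hf hx.1.le, lipTrunc_apply_of_abs_le hf hx.2.le]
  filter_upwards [key] with x hx n hn
  exact hx _ n ⟨by push_cast; exact Nat.lt_floor_add_one _, hn⟩

lemma ext_add_const_mul_ae (δ : MetricDerivation μ) {f g h : X → ℝ} (hf : IsLip f) (hg : IsLip g)
    (hh : IsLip h) (c : ℝ) (hfg : ∀ x, h x = f x + c * g x) :
    ∀ᵐ x ∂μ, δ.ext h hh x = δ.ext f hf x + c * δ.ext g hg x := by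
  have key : ∀ᵐ x ∂μ, ∀ n : ℕ, |f x| < n ∧ |g x| < n ∧ |h x| < n →
      δ.toFun (lipTrunc h hh n) x = δ.toFun (lipTrunc f hf n + c • lipTrunc g hg n) x := by
    refine ae_all_iff.2 fun n => ?_
    refine δ.ae_eq_of_eqOn (U := {x | |f x| < n ∧ |g x| < n ∧ |h x| < n}) ?_ fun x hx => ?_
    · exact (isOpen_lt hf.continuous.abs continuous_const).inter
        ((isOpen_lt hg.continuous.abs continuous_const).inter
          (isOpen_lt hh.continuous.abs continuous_const))
    · change _ = (lipTrunc f hf n).1 x + c * (lipTrunc g hg n).1 x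
      rw [lipTrunc_apply_of_abs_le hf hx.1.le, lipTrunc_apply_of_abs_le hg hx.2.1.le,
        lipTrunc_apply_of_abs_le hh hx.2.2.le, hfg]
  have hlin : ∀ᵐ x ∂μ, ∀ n : ℕ, δ.toFun (lipTrunc f hf n + c • lipTrunc g hg n) x =
      δ.toFun (lipTrunc f hf n) x + c * δ.toFun (lipTrunc g hg n) x :=
    ae_all_iff.2 fun n => δ.toFun_add_smul_ae _ _ c
  filter_upwards [key, hlin, δ.ext_ae_eq_toFun hf, δ.ext_ae_eq_toFun hg, δ.ext_ae_eq_toFun hh]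
    with x h₁ h₂ h₃ h₄ h₅
  obtain ⟨n, hn⟩ := exists_nat_gt (max |f x| (max |g x| |h x|))
  obtain ⟨hn₁, hn'⟩ := max_lt_iff.1 hn
  obtain ⟨hn₂, hn₃⟩ := max_lt_iff.1 hn'
  rw [h₃ n hn₁, h₄ n hn₂, h₅ n hn₃, h₁ n ⟨hn₁, hn₂, hn₃⟩, h₂ n]

lemma ext_add_sum_ae (δ : MetricDerivation μ) {ι : Type*} {f h : X → ℝ} {g : ι → X → ℝ}
    (hf : IsLip f) (hg : ∀ i, IsLip (g i)) (hh : IsLip h) (c : ι → ℝ) (s : Finset ι)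
    (hfg : ∀ x, h x = f x + ∑ i ∈ s, c i * g i x) :
    ∀ᵐ x ∂μ, δ.ext h hh x = δ.ext f hf x + ∑ i ∈ s, c i * δ.ext (g i) (hg i) x := by
  classical
  induction s using Finset.induction_on generalizing h with
  | empty =>
    obtain rfl : h = f := funext fun x => by simp [hfg]
    simp
  | insert a s ha ih =>
    have hs := hf.add_sum hg c s
    filter_upwards [ih hs fun _ => rfl, δ.ext_add_const_mul_ae hs (hg a) hh (c a) fun x => by
      rw [hfg, Finset.sum_insert ha]; ring] with x h₁ h₂
    rw [h₂, h₁, Finset.sum_insert ha]; ring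

lemma measurable_toFun (δ : MetricDerivation μ) (f : LipB X) : Measurable (δ.toFun f) :=
  (Lp.stronglyMeasurable _).measurable

lemma measurable_ext [OpensMeasurableSpace X] (δ : MetricDerivation μ) {f : X → ℝ} (hf : IsLip f) :
    Measurable (δ.ext f hf) := by
  have key : ∀ (F : ℕ → X → ℝ) (k : X → ℕ), (∀ n, Measurable (F n)) → Measurable k →
      Measurable fun x => F (k x) x := fun F k hF hk =>
    (measurable_from_prod_countable_right (f := fun p : ℕ × X => F p.1 p.2) hF).comp
      (hk.prodMk measurable_id)
  exact key (fun n => δ.toFun (lipTrunc f hf (n + 1))) (fun x => ⌊|f x|⌋₊)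
    (fun n => δ.measurable_toFun _) (Nat.measurable_floor.comp hf.continuous.abs.measurable)

end MetricDerivation

/-! ### Measurable kernel vectors -/

/-- A family of measurable vector fields which is linearly dependent at every point of a set `E`
of positive measure satisfies a measurable linear relation which is non-trivial on a subset
of positive measure. -/
lemma exists_measurable_relation {X : Type*} [MeasurableSpace X] {μ : Measure X} {N : ℕ} :
    ∀ {m : ℕ} (a : Fin m → Fin N → X → ℝ), (∀ j i, Measurable (a j i)) →
      ∀ E : Set X, MeasurableSet E → μ E ≠ 0 →
      (∀ x ∈ E, ∃ v : Fin m → ℝ, v ≠ 0 ∧ ∀ i, ∑ j, v j * a j i x = 0) →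
      ∃ c : Fin m → X → ℝ, (∀ j, Measurable (c j)) ∧ ∃ F ⊆ E, MeasurableSet F ∧ μ F ≠ 0 ∧
        (∀ x ∈ F, ∃ j, c j x ≠ 0) ∧ ∀ x ∈ F, ∀ i, ∑ j, c j x * a j i x = 0
  | 0, a, _, E, _, hE, h => by
    obtain ⟨x, hx⟩ := nonempty_of_measure_ne_zero hE
    obtain ⟨v, hv, -⟩ := h x hx
    exact absurd (Subsingleton.elim v 0) hv
  | m + 1, a, ha, E, hEm, hE, h => by
    -- Gaussian elimination: if the last field has a component `i₀` that is nonzero on a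
    -- positive-measure part of `E`, pivot there and recurse on the remaining `m` fields; otherwise
    -- the last field is almost everywhere zero on `E` and is itself the relation.
    by_cases h0 : ∃ i, μ (E ∩ {x | a (Fin.last m) i x ≠ 0}) ≠ 0
    · obtain ⟨i₀, hi₀⟩ := h0
      have hmE : MeasurableSet (E ∩ {x | a (Fin.last m) i₀ x ≠ 0}) :=
        hEm.inter ((ha _ i₀) (measurableSet_singleton 0).compl)
      obtain ⟨c, hc, F, hFE, hFm, hF, hne, hrel⟩ := exists_measurable_relation
        (fun j i x => a j.castSucc i x -
          a j.castSucc i₀ x / a (Fin.last m) i₀ x * a (Fin.last m) i x)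
        (fun j i => by have := ha; fun_prop) _ hmE hi₀ (by
          rintro x ⟨hxE, hx0⟩
          obtain ⟨v, hv, hrel⟩ := h x hxE
          have hx0 : a (Fin.last m) i₀ x ≠ 0 := hx0
          have hlast : ∑ j : Fin m, v j.castSucc * a j.castSucc i₀ x =
              -(v (Fin.last m) * a (Fin.last m) i₀ x) := by
            have := hrel i₀
            rw [Fin.sum_univ_castSucc] at this
            linarith
          refine ⟨fun j => v j.castSucc, fun hz => hv ?_, fun i => ?_⟩
          · have hz' : ∀ j : Fin m, v j.castSucc = 0 := fun j => congrFun hz j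
            simp only [hz', zero_mul, Finset.sum_const_zero] at hlast
            funext j
            refine Fin.lastCases ?_ hz' j
            simpa [hx0] using hlast.symm
          · have h1 : ∑ j : Fin m, v j.castSucc * (a j.castSucc i x -
                a j.castSucc i₀ x / a (Fin.last m) i₀ x * a (Fin.last m) i x) =
                ∑ j : Fin m, v j.castSucc * a j.castSucc i x -
                (∑ j : Fin m, v j.castSucc * a j.castSucc i₀ x) / a (Fin.last m) i₀ x *
                  a (Fin.last m) i x := by
              rw [Finset.sum_div, Finset.sum_mul, ← Finset.sum_sub_distrib]
              exact Finset.sum_congr rfl fun j _ => by ring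
            have h2 := hrel i
            rw [Fin.sum_univ_castSucc] at h2
            rw [h1, hlast]
            field_simp
            linarith)
      -- The last coefficient is forced by the equation in the pivot component `i₀`.
      refine ⟨Fin.snoc c fun x => -(∑ j, c j x * a j.castSucc i₀ x) / a (Fin.last m) i₀ x,
        fun j => ?_, F, hFE.trans inter_subset_left, hFm, hF, fun x hx => ?_, fun x hx i => ?_⟩
      · refine Fin.lastCases ?_ (fun j => ?_) j
        · rw [Fin.snoc_last]
          have := ha
          fun_prop
        · rw [Fin.snoc_castSucc]
          exact hc j
      · obtain ⟨j, hj⟩ := hne x hx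
        exact ⟨j.castSucc, by simpa using hj⟩
      · have h1 := hrel x hx i
        simp only [mul_sub, Finset.sum_sub_distrib] at h1
        rw [Fin.sum_univ_castSucc]
        simp only [Fin.snoc_castSucc, Fin.snoc_last]
        rw [← h1]
        have : ∑ j, c j x * (a j.castSucc i₀ x / a (Fin.last m) i₀ x * a (Fin.last m) i x) =
            (∑ j, c j x * a j.castSucc i₀ x) / a (Fin.last m) i₀ x * a (Fin.last m) i x := by
          rw [Finset.sum_div, Finset.sum_mul]
          exact Finset.sum_congr rfl fun j _ => by ring
        rw [this]; ring
    · push Not at h0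
      have hZ : μ (⋃ i, E ∩ {x | a (Fin.last m) i x ≠ 0}) = 0 := measure_iUnion_null h0
      refine ⟨fun j _ => if j = Fin.last m then 1 else 0, fun j => measurable_const,
        E \ ⋃ i, E ∩ {x | a (Fin.last m) i x ≠ 0}, sdiff_subset, ?_, ?_,
        fun x _ => ⟨Fin.last m, by simp⟩, fun x hx i => ?_⟩
      · exact hEm.diff (MeasurableSet.iUnion fun i =>
          hEm.inter ((ha _ i) (measurableSet_singleton 0).compl))
      · rwa [measure_sdiff_null hZ]
      · have : a (Fin.last m) i x = 0 := by
          by_contra hne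
          exact hx.2 (mem_iUnion.2 ⟨i, hx.1, hne⟩)
        simp [this]

/-! ### Combinations of derivations with bounded coefficients -/

section DerivComb

variable {X : Type*} [PseudoMetricSpace X] [MeasurableSpace X] {μ : Measure X} {m : ℕ}

/-- The combination `∑ j, c j * δ j` of derivations with bounded coefficients. -/
noncomputable def derivComb (c : Fin m → Lp ℝ ∞ μ) (δ : Fin m → MetricDerivation μ)
    (f : LipB X) (x : X) : ℝ :=
  ∑ j, c j x * (δ j).toFun f x

variable (c : Fin m → Lp ℝ ∞ μ) (δ : Fin m → MetricDerivation μ)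

lemma memLp_derivComb (f : LipB X) : MemLp (derivComb c δ f) ∞ μ :=
  memLp_finsetSum _ fun j _ => (Lp.memLp ((δ j).toFun f)).mul (Lp.memLp (c j))

lemma derivComb_mul_ae (f h : LipB X) :
    ∀ᵐ x ∂μ, derivComb c δ (f * h) x =
      f.1 x * derivComb c δ h x + h.1 x * derivComb c δ f x := by
  filter_upwards [ae_all_iff.2 fun j => (δ j).leibniz f h] with x hx
  simp only [derivComb, Finset.mul_sum, ← Finset.sum_add_distrib]
  exact Finset.sum_congr rfl fun j _ => by rw [hx j]; ring

lemma derivComb_add_smul_ae (f h : LipB X) (a : ℝ) :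
    ∀ᵐ x ∂μ, derivComb c δ (f + a • h) x = derivComb c δ f x + a * derivComb c δ h x := by
  filter_upwards [ae_all_iff.2 fun j => (δ j).toFun_add_smul_ae f h a] with x hx
  simp only [derivComb, Finset.mul_sum, ← Finset.sum_add_distrib]
  exact Finset.sum_congr rfl fun j _ => by rw [hx j]; ring

lemma derivComb_one_ae : ∀ᵐ x ∂μ, derivComb c δ 1 x = 0 := by
  filter_upwards [derivComb_mul_ae c δ 1 1] with x hx
  have h1 : (1 : LipB X).1 x = 1 := rfl
  rw [mul_one, h1] at hx
  linarith

lemma derivComb_aeval_ae {N : ℕ} (G : Fin N → LipB X) (U : Set X)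
    (hG : ∀ i, ∀ᵐ x ∂μ, x ∈ U → derivComb c δ (G i) x = 0) (p : MvPolynomial (Fin N) ℝ) :
    ∀ᵐ x ∂μ, x ∈ U → derivComb c δ (MvPolynomial.aeval G p) x = 0 := by
  have h0 : ∀ᵐ x ∂μ, derivComb c δ 0 x = 0 := by
    filter_upwards [derivComb_mul_ae c δ 0 0] with x hx
    have h1 : (0 : LipB X).1 x = 0 := rfl
    rwa [mul_zero, h1, zero_mul, add_zero] at hx
  induction p using MvPolynomial.induction_on with
  | C a =>
    filter_upwards [derivComb_add_smul_ae c δ 0 1 a, derivComb_one_ae c δ, h0] with x h₁ h₂ h₃ _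
    rw [MvPolynomial.aeval_C, Algebra.algebraMap_eq_smul_one]
    rw [zero_add, h₂, h₃] at h₁
    rw [h₁]; ring
  | add p q hp hq =>
    filter_upwards [hp, hq, derivComb_add_smul_ae c δ (MvPolynomial.aeval G p)
      (MvPolynomial.aeval G q) 1] with x h₁ h₂ h₃ hx
    rw [one_smul] at h₃
    rw [map_add, h₃, h₁ hx, h₂ hx]; ring
  | mul_X p i hp =>
    filter_upwards [hp, hG i, derivComb_mul_ae c δ (MvPolynomial.aeval G p) (G i)]
      with x h₁ h₂ h₃ hx
    rw [map_mul, MvPolynomial.aeval_X, h₃, h₁ hx, h₂ hx]; ring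

lemma integrable_mul_derivComb {φ : X → ℝ} (hφ : Integrable φ μ) (f : LipB X) :
    Integrable (fun x => φ x * derivComb c δ f x) μ :=
  hφ.mul_of_top_left (memLp_derivComb c δ f)

/-- The bounded coefficients are absorbed into the test function: `φ c_j` is again integrable. -/
lemma tendsto_integral_derivComb {u : ℕ → LipB X} {f : LipB X} (hu : LipWeakStar u f)
    {φ : X → ℝ} (hφ : Integrable φ μ) :
    Tendsto (fun k => ∫ x, φ x * derivComb c δ (u k) x ∂μ) atTop
      (𝓝 (∫ x, φ x * derivComb c δ f x ∂μ)) := by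
  have hφc : ∀ j, Integrable (fun x => φ x * c j x) μ := fun j =>
    hφ.mul_of_top_left (Lp.memLp (c j))
  have key : ∀ h : LipB X, ∫ x, φ x * derivComb c δ h x ∂μ =
      ∑ j, ∫ x, (φ x * c j x) * (δ j).toFun h x ∂μ := fun h => by
    rw [← integral_finsetSum]
    · refine integral_congr_ae (ae_of_all _ fun x => ?_)
      simp only [derivComb, Finset.mul_sum, mul_assoc]
    · exact fun j _ => (hφc j).mul_of_top_left (Lp.memLp ((δ j).toFun h))
  simp only [key]
  exact tendsto_finsetSum _ fun j _ => (δ j).weakCont u f hu _ (hφc j)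

end DerivComb

section Generators

variable {X : Type*} [PseudoMetricSpace X]

lemma LipB.aeval_apply {N : ℕ} (G : Fin N → LipB X) (p : MvPolynomial (Fin N) ℝ) (x : X) :
    (MvPolynomial.aeval G p).1 x = MvPolynomial.eval (fun i => (G i).1 x) p := by
  have := MvPolynomial.comp_aeval_apply G
    ((Pi.evalAlgHom ℝ (fun _ : X => ℝ) x).comp (LipB X).val) p
  rw [← MvPolynomial.coe_aeval_eq_eval]
  exact this

/-- Multiplying weakly-* convergent functions on an open set `U` with a cutoff function
of `U` produces weakly-* convergent functions on the whole space. -/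
lemma LipWeakStar.cutoff_mul {U : Set X} {u : ℕ → LipB U} {f : LipB X}
    (hu : LipWeakStar u (lipRestrict f U)) {χ : LipB X} (h₁ : ∀ x, |χ.1 x| ≤ 1)
    (h₂ : ∀ x y, |χ.1 x - χ.1 y| ≤ dist x y) (h₃ : ∀ x, χ.1 x = 0 ↔ x ∉ U)
    {w : ℕ → LipB X} (hw : ∀ n (y : U), (w n).1 y = (u n).1 y) :
    LipWeakStar (fun n => χ * w n) (χ * f) := by
  obtain ⟨⟨C, hC⟩, hlim⟩ := hu
  have hmul : ∀ n x, (χ * w n).1 x = χ.1 x * (w n).1 x := fun _ _ => rfl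
  have hwC : ∀ n, ∀ x ∈ U, |(w n).1 x| ≤ max C 0 := fun n x hx => by
    have := (LipB.abs_le_lipNorm (u n) ⟨x, hx⟩).trans ((hC n).trans (le_max_left C 0))
    rwa [← hw n] at this
  have hwL : ∀ n, ∀ x ∈ U, ∀ y ∈ U, |(w n).1 x - (w n).1 y| ≤ max C 0 * dist x y :=
    fun n x hx y hy => by
      have := LipB.abs_sub_le_lipNorm (u n) ⟨x, hx⟩ ⟨y, hy⟩
      rw [← hw n, ← hw n] at this
      exact this.trans (mul_le_mul_of_nonneg_right ((hC n).trans (le_max_left C 0)) dist_nonneg)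
  have hC0 : 0 ≤ max C 0 := le_max_right _ _
  -- Nothing is known about `w n` outside `U`; since `χ y = 0`, the Lipschitz bound of `χ` and the
  -- bound of `w n` at `x` suffice.
  have hone : ∀ n, ∀ x ∈ U, ∀ y ∉ U,
      |χ.1 x * (w n).1 x - χ.1 y * (w n).1 y| ≤ 2 * max C 0 * dist x y := fun n x hx y hy => by
    have h0 := (h₃ y).2 hy
    have := h₂ x y
    rw [h0, sub_zero] at this
    rw [h0, zero_mul, sub_zero, abs_mul, mul_comm]
    have h4 := mul_le_mul (hwC n x hx) this (abs_nonneg _) hC0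
    nlinarith [mul_nonneg hC0 (dist_nonneg (x := x) (y := y))]
  refine ⟨⟨2 * max C 0, fun n => lipNorm_le (by positivity) (fun x y => ?_) fun x => ?_⟩,
    fun x => ?_⟩
  · rw [hmul, hmul]
    by_cases hx : x ∈ U <;> by_cases hy : y ∈ U
    · have h4 : χ.1 x * (w n).1 x - χ.1 y * (w n).1 y =
          χ.1 x * ((w n).1 x - (w n).1 y) + (w n).1 y * (χ.1 x - χ.1 y) := by ring
      rw [h4]
      refine (abs_add_le _ _).trans ?_
      rw [abs_mul, abs_mul]
      have h5 := mul_le_mul (h₁ x) (hwL n x hx y hy) (abs_nonneg _) zero_le_one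
      have h6 := mul_le_mul (hwC n y hy) (h₂ x y) (abs_nonneg _) hC0
      linarith
    · exact hone n x hx y hy
    · rw [abs_sub_comm, dist_comm]
      exact hone n y hy x hx
    · rw [(h₃ x).2 hx, (h₃ y).2 hy, zero_mul, zero_mul, sub_zero, abs_zero]
      positivity
  · rw [hmul, abs_mul]
    by_cases hx : x ∈ U
    · have := mul_le_mul (h₁ x) (hwC n x hx) (abs_nonneg _) zero_le_one
      linarith
    · rw [(h₃ x).2 hx, abs_zero, zero_mul]
      positivity
  · change Tendsto (fun n => χ.1 x * (w n).1 x) atTop (𝓝 (χ.1 x * f.1 x))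
    by_cases hx : x ∈ U
    · have := (hlim ⟨x, hx⟩).const_mul (χ.1 x)
      simp only [← hw] at this
      exact this
    · simp [(h₃ x).2 hx]

lemma exists_abs_lt_on_ball {N : ℕ} {g : Fin N → X → ℝ} (hg : ∀ i, IsLip (g i)) (x₀ : X) (r : ℝ) :
    ∃ n : ℕ, ∀ i, ∀ x ∈ ball x₀ r, |g i x| < n := by
  choose L hL using hg
  obtain ⟨n, hn⟩ := exists_nat_gt (∑ i, (|g i x₀| + L i * |r|))
  refine ⟨n, fun i x hx => lt_of_le_of_lt ?_ hn⟩
  have h1 := (hL i).dist_le_mul x x₀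
  rw [Real.dist_eq] at h1
  have h2 : (L i : ℝ) * dist x x₀ ≤ L i * |r| :=
    mul_le_mul_of_nonneg_left ((mem_ball.1 hx).le.trans (le_abs_self r)) (L i).2
  have h3 : |g i x| ≤ |g i x₀| + L i * |r| := by
    have := abs_sub_abs_le_abs_sub (g i x) (g i x₀)
    linarith
  refine h3.trans (Finset.single_le_sum (f := fun i => |g i x₀| + L i * |r|)
    (fun j _ => ?_) (Finset.mem_univ i))
  positivity

variable [MeasurableSpace X] [OpensMeasurableSpace X] {μ : Measure X} {m N : ℕ}

/-- A combination of derivations that annihilates the generators is zero on every ball. -/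
lemma derivComb_ae_eq_zero_on_ball [SigmaFinite μ] (c : Fin m → Lp ℝ ∞ μ)
    (δ : Fin m → MetricDerivation μ) {g : Fin N → X → ℝ} (hg : Generates g)
    (hc : ∀ i, ∀ᵐ x ∂μ, ∑ j, c j x * (δ j).ext (g i) (hg.1 i) x = 0) (f : LipB X) (x₀ : X)
    {r : ℝ} (hr : 0 < r) : ∀ᵐ x ∂μ, x ∈ ball x₀ r → derivComb c δ f x = 0 := by
  obtain ⟨p, u, hpu, hu⟩ := hg.2 x₀ r hr f
  obtain ⟨n, hn⟩ := exists_abs_lt_on_ball hg.1 x₀ r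
  obtain ⟨χ, h₁, h₂, h₃⟩ := exists_cutoff (isOpen_ball (x := x₀) (ε := r))
  -- Truncation changes nothing on the ball, and makes polynomials in the generators bounded
  -- Lipschitz functions on all of `X`.
  set G : Fin N → LipB X := fun i => lipTrunc (g i) (hg.1 i) n with hGdef
  set w : ℕ → LipB X := fun k => MvPolynomial.aeval G (p k) with hwdef
  have hw : ∀ k (y : ball x₀ r), (w k).1 y = (u k).1 y := fun k y => by
    rw [hpu, hwdef, LipB.aeval_apply]
    congr 1
    refine congrArg _ (funext fun i => ?_)
    exact lipTrunc_apply_of_abs_le (hg.1 i) (hn i y y.2).le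
  have hweak := hu.cutoff_mul h₁ h₂ h₃ hw
  have hG : ∀ i, ∀ᵐ x ∂μ, x ∈ ball x₀ r → derivComb c δ (G i) x = 0 := fun i => by
    filter_upwards [hc i, ae_all_iff.2 fun j => (δ j).ext_ae_eq_toFun (hg.1 i)] with x hx hE hxB
    rw [← hx]
    exact Finset.sum_congr rfl fun j _ => by rw [hE j n (hn i x hxB)]
  obtain ⟨⟨C, hC⟩, hlim⟩ := hu
  have hχm : Measurable χ.1 := by
    obtain ⟨⟨L, hL⟩, -⟩ := χ.2
    exact hL.continuous.measurable
  -- Write `D` for the combination. On the ball `D (w k) = 0`, so `D (χ w_k) = w_k Dχ`, which tends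
  -- to `f Dχ` by dominated convergence, while weak-* continuity gives the limit `D (χ f) = f Dχ + χ
  -- Df`. Comparing leaves `χ Df`; the second factor `χ` comes from the test function, which
  -- confines the integrals to the ball.
  have key : ∀ s : Set X, MeasurableSet s → μ s < ∞ →
      ∫ x in s, χ.1 x * (χ.1 x * derivComb c δ f x) ∂μ = 0 := fun s hs hμs => by
    have hφ : Integrable (s.indicator χ.1) μ := by
      refine (integrable_indicator_iff hs).2 ?_
      refine Measure.integrableOn_of_bounded hμs.ne hχm.aestronglyMeasurable (M := 1) ?_
      exact ae_of_all _ h₁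
    set φ := s.indicator χ.1 with hφdef
    have hφ0 : ∀ x ∉ ball x₀ r, φ x = 0 := fun x hx => by
      exact indicator_apply_eq_zero.2 fun _ => (h₃ x).2 hx
    have hl₁ := tendsto_integral_derivComb c δ hweak hφ
    have hl₂ : Tendsto (fun k => ∫ x, φ x * derivComb c δ (χ * w k) x ∂μ) atTop
        (𝓝 (∫ x, f.1 x * (φ x * derivComb c δ χ x) ∂μ)) := by
      refine tendsto_integral_of_dominated_convergence
        (fun x => C * ‖φ x * derivComb c δ χ x‖)
        (fun k => (integrable_mul_derivComb c δ hφ _).aestronglyMeasurable)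
        ((integrable_mul_derivComb c δ hφ χ).norm.const_mul C) (fun k => ?_) ?_
      · filter_upwards [derivComb_mul_ae c δ χ (w k), derivComb_aeval_ae c δ G _ hG (p k)]
          with x hx₁ hx₂
        by_cases hx : x ∈ ball x₀ r
        · have hb := (LipB.abs_le_lipNorm (u k) ⟨x, hx⟩).trans (hC k)
          rw [← hw k] at hb
          rw [hx₁, hx₂ hx, mul_zero, zero_add, mul_left_comm, norm_mul]
          exact mul_le_mul_of_nonneg_right hb (norm_nonneg _)
        · simp [hφ0 x hx]
      · filter_upwards [ae_all_iff.2 fun k => derivComb_mul_ae c δ χ (w k),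
          ae_all_iff.2 fun k => derivComb_aeval_ae c δ G _ hG (p k)] with x hx₁ hx₂
        by_cases hx : x ∈ ball x₀ r
        · have := (hlim ⟨x, hx⟩).mul_const (φ x * derivComb c δ χ x)
          simp only [← hw] at this
          refine this.congr fun k => ?_
          rw [hx₁ k, hx₂ k hx, mul_zero, zero_add, mul_left_comm]
        · simp [hφ0 x hx]
    have heq := tendsto_nhds_unique hl₁ hl₂
    have hexp : (fun x => φ x * derivComb c δ (χ * f) x) =ᵐ[μ] fun x =>
        f.1 x * (φ x * derivComb c δ χ x) +
          s.indicator (fun x => χ.1 x * (χ.1 x * derivComb c δ f x)) x := by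
      filter_upwards [derivComb_mul_ae c δ χ f] with x hx
      rw [hx, hφdef]
      by_cases hxs : x ∈ s
      · rw [indicator_of_mem hxs, indicator_of_mem hxs]; ring
      · rw [indicator_of_notMem hxs, indicator_of_notMem hxs]; ring
    have hfm : MemLp f.1 ∞ μ := by
      obtain ⟨⟨L, hL⟩, D, hD⟩ := f.2
      exact memLp_top_of_bound hL.continuous.measurable.aestronglyMeasurable D (ae_of_all _ hD)
    have hχL : MemLp χ.1 ∞ μ := memLp_top_of_bound hχm.aestronglyMeasurable 1 (ae_of_all _ h₁)
    have hi₁ : Integrable (fun x => f.1 x * (φ x * derivComb c δ χ x)) μ :=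
      (integrable_mul_derivComb c δ hφ χ).mul_of_top_right hfm
    have hi₂ : Integrable (s.indicator fun x => χ.1 x * (χ.1 x * derivComb c δ f x)) μ := by
      have := (integrable_mul_derivComb c δ hφ f).mul_of_top_right hχL
      refine this.congr (ae_of_all _ fun x => ?_)
      by_cases hxs : x ∈ s <;> simp [hφdef, hxs]
    rw [integral_congr_ae hexp, integral_add hi₁ hi₂, integral_indicator hs] at heq
    linarith
  have hzero := ae_eq_zero_of_forall_setIntegral_eq_of_sigmaFinite (μ := μ)
    (f := fun x => χ.1 x * (χ.1 x * derivComb c δ f x)) (fun s hs hμs => ?_) key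
  · filter_upwards [hzero] with x hx hxB
    have hne : χ.1 x ≠ 0 := fun h => (h₃ x).1 h hxB
    simpa [hne] using hx
  · have hχL : MemLp χ.1 ∞ μ := memLp_top_of_bound hχm.aestronglyMeasurable 1 (ae_of_all _ h₁)
    have h4 : MemLp (fun x => χ.1 x * (χ.1 x * derivComb c δ f x)) ∞ μ :=
      MemLp.mul (r := ∞) (MemLp.mul (r := ∞) (memLp_derivComb c δ f) hχL) hχL
    have : IsFiniteMeasure (μ.restrict s) := ⟨by simpa using hμs⟩
    exact (h4.restrict s).integrable le_top

/-- A combination of derivations that annihilates the generators is zero. -/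
lemma derivComb_ae_eq_zero [SigmaFinite μ] (c : Fin m → Lp ℝ ∞ μ)
    (δ : Fin m → MetricDerivation μ) {g : Fin N → X → ℝ} (hg : Generates g)
    (hc : ∀ i, ∀ᵐ x ∂μ, ∑ j, c j x * (δ j).ext (g i) (hg.1 i) x = 0) (f : LipB X) :
    ∀ᵐ x ∂μ, derivComb c δ f x = 0 := by
  rcases isEmpty_or_nonempty X with _ | ⟨⟨x₀⟩⟩
  · exact ae_of_all _ fun x => isEmptyElim x
  · filter_upwards [ae_all_iff.2 fun n : ℕ => derivComb_ae_eq_zero_on_ball c δ hg hc f x₀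
      (r := n + 1) (by positivity)] with x hx
    obtain ⟨n, hn⟩ := exists_nat_gt (dist x x₀)
    exact hx n (mem_ball.2 (hn.trans (lt_add_one _)))

/-- Column rank `m` equals row rank, so a basis of the row space chosen among the rows has `m`
members. -/
lemma Matrix.exists_submatrix_det_ne_zero (A : Matrix (Fin N) (Fin m) ℝ)
    (hA : ∀ v, A.mulVec v = 0 → v = 0) :
    ∃ I : Fin m → Fin N, (A.submatrix I id).det ≠ 0 := by
  have hcol : LinearIndependent ℝ A.col := Matrix.mulVec_injective_iff.1 <|
    (injective_iff_map_eq_zero A.mulVecLin).2 hA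
  have hrank : Module.finrank ℝ (Submodule.span ℝ (range A.row)) = m := by
    rw [← A.rank_eq_finrank_span_row, ← Matrix.rank_transpose]
    simpa using LinearIndependent.rank_matrix (M := A.transpose) hcol
  obtain ⟨κ, a, ha, hspan, hli⟩ := exists_linearIndependent' ℝ A.row
  have : Finite κ := Finite.of_injective a ha
  have : Fintype κ := Fintype.ofFinite κ
  have hcard : Fintype.card κ = m := by
    rw [← hrank, ← hspan, finrank_span_eq_card hli]
  let e : Fin m ≃ κ := (Fintype.equivFinOfCardEq hcard).symm
  refine ⟨a ∘ e, ?_⟩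
  have h : LinearIndependent ℝ (A.submatrix (a ∘ e) id).row := hli.comp e e.injective
  exact ((Matrix.isUnit_iff_isUnit_det _).1 (Matrix.linearIndependent_rows_iff_isUnit.1 h)).ne_zero

/-- The derivatives of the generators under linearly independent derivations
have a non-vanishing minor of full size almost everywhere. -/
lemma DerivLinIndep.ae_exists_det_ne_zero [SigmaFinite μ] {δ : Fin m → MetricDerivation μ}
    (hδ : DerivLinIndep δ) {g : Fin N → X → ℝ} (hg : Generates g) :
    ∀ᵐ x ∂μ, ∃ I : Fin m → Fin N,
      (Matrix.of fun i j => (δ j).ext (g (I i)) (hg.1 (I i)) x).det ≠ 0 := by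
  have hmeas : ∀ j i, Measurable ((δ j).ext (g i) (hg.1 i)) := fun j i => (δ j).measurable_ext _
  set E : Set X := {x | ∀ I : Fin m → Fin N,
    (Matrix.of fun i j => (δ j).ext (g (I i)) (hg.1 (I i)) x).det = 0} with hEdef
  have hEm : MeasurableSet E := by
    have hE' : E = ⋂ I : Fin m → Fin N, {x |
        (Matrix.of fun i j => (δ j).ext (g (I i)) (hg.1 (I i)) x).det = 0} := by
      ext x; simp [hEdef]
    rw [hE']
    refine MeasurableSet.iInter fun I => measurableSet_eq_fun ?_ measurable_const
    simp only [Matrix.det_apply, Matrix.of_apply]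
    fun_prop
  have hE0 : μ E = 0 := by
    by_contra hE
    obtain ⟨c, hc, F, hFE, hFm, hF, hne, hrel⟩ := exists_measurable_relation
      (fun j i => (δ j).ext (g i) (hg.1 i)) hmeas E hEm hE (fun x hx => by
        by_contra! hcon
        obtain ⟨I, hI⟩ := Matrix.exists_submatrix_det_ne_zero
          (Matrix.of fun i j => (δ j).ext (g i) (hg.1 i) x) fun v hv => by
            by_contra hv0
            obtain ⟨i, hi⟩ := hcon v hv0
            refine hi ?_
            simpa [Matrix.mulVec, dotProduct, mul_comm] using congrFun hv i
        exact hI (hx I))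
    -- Rescaling bounds the coefficients by `1`, and the indicator extends the relation by zero off
    -- `F`.
    set b : Fin m → X → ℝ := fun j => F.indicator fun x => c j x / (1 + ∑ k, |c k x|) with hbdef
    have hpos : ∀ x, 0 < 1 + ∑ k, |c k x| := fun x => by positivity
    have hb : ∀ j, MemLp (b j) ∞ μ := fun j => by
      refine memLp_top_of_bound (Measurable.aestronglyMeasurable ?_) 1 (ae_of_all _ fun x => ?_)
      · exact Measurable.indicator (by fun_prop) hFm
      · refine (norm_indicator_le_norm_self _ _).trans ?_
        rw [Real.norm_eq_abs, abs_div, abs_of_pos (hpos x), div_le_one (hpos x)]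
        have := Finset.single_le_sum (f := fun k => |c k x|) (fun _ _ => abs_nonneg _)
          (Finset.mem_univ j)
        linarith
    have hzero := hδ (fun j => (hb j).toLp) fun f => derivComb_ae_eq_zero _ δ hg (fun i => by
      filter_upwards [ae_all_iff.2 fun j => (hb j).coeFn_toLp] with x hx
      simp only [hx]
      by_cases hxF : x ∈ F
      · simp only [hbdef, indicator_of_mem hxF, div_mul_eq_mul_div, ← Finset.sum_div,
          hrel x hxF i, zero_div]
      · simp [hbdef, indicator_of_notMem hxF]) f
    refine hF (measure_mono_null (t := {x | ¬ ∀ j, b j x = 0}) (fun x hx h => ?_) ?_)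
    · obtain ⟨j, hj⟩ := hne x hx
      have := h j
      simp only [hbdef, indicator_of_mem hx] at this
      exact (div_ne_zero hj (hpos x).ne') this
    · refine ae_all_iff.2 fun j => ?_
      filter_upwards [(hb j).coeFn_toLp, Lp.coeFn_zero ℝ ∞ μ] with x h₁ h₂
      rw [← h₁, hzero j, h₂, Pi.zero_apply]
  filter_upwards [measure_eq_zero_iff_ae_notMem.1 hE0] with x hx
  simpa [hEdef] using hx

end Generators

/-! ### The pointwise Lipschitz constant -/

section PointLip

variable {X : Type*} [PseudoMetricSpace X]

/-- At every scale `r` the perturbation changes the difference quotient by at most `L`. This makes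
`Lip[f - v · η](x)` continuous in `v`. -/
lemma pointLip_le_add {f₁ f₂ h : X → ℝ} {L : ℝ≥0} (hL : LipschitzWith L h)
    (hf : ∀ y, f₁ y = f₂ y + h y) (x : X) : pointLip f₁ x ≤ pointLip f₂ x + L := by
  rw [pointLip, pointLip, ← limsup_add_const _ _ _ (by isBoundedDefault) (by isBoundedDefault)]
  refine limsup_le_limsup ?_
  filter_upwards [self_mem_nhdsWithin] with r hr
  have hr : 0 < r := hr
  refine iSup₂_le fun y hy => ?_
  refine le_trans ?_ (add_le_add_left (le_iSup₂ y hy) _)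
  rw [← ENNReal.ofReal_coe_nnreal, ← ENNReal.ofReal_add (by positivity) L.coe_nonneg]
  refine ENNReal.ofReal_le_ofReal ?_
  rw [div_add' _ _ _ hr.ne']
  refine div_le_div_of_nonneg_right ?_ hr.le
  have h1 := hL.dist_le_mul y x
  rw [Real.dist_eq] at h1
  have h2 : (L : ℝ) * dist y x ≤ L * r := mul_le_mul_of_nonneg_left (mem_closedBall.1 hy) L.2
  have h3 : f₁ y - f₁ x = (f₂ y - f₂ x) + (h y - h x) := by rw [hf, hf]; ring
  rw [h3]
  exact (abs_add_le _ _).trans (by linarith)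

lemma pointLip_le {f : X → ℝ} {L : ℝ≥0} (hL : LipschitzWith L f) (x : X) : pointLip f x ≤ L := by
  have h0 : pointLip (fun _ : X => (0 : ℝ)) x = 0 := by simp [pointLip]
  simpa [h0] using pointLip_le_add hL (f₂ := fun _ => 0) (fun y => by simp) x

lemma isLip_toLp {m : ℕ} {η : Fin m → X → ℝ} (hη : ∀ i, IsLip (η i)) :
    IsLip fun y => (WithLp.toLp 2 fun i => η i y : EuclideanSpace ℝ (Fin m)) := by
  choose L hL using hη
  refine ⟨_, (PiLp.lipschitzWith_toLp 2 _).comp (LipschitzWith.of_dist_le_mul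
    (K := ∑ i, L i) fun x y => (dist_pi_le_iff (by positivity)).2 fun i => ?_)⟩
  refine LipschitzWith.dist_le_mul ?_ x y
  exact (hL i).weaken (Finset.single_le_sum (f := L) (fun _ _ => zero_le) (Finset.mem_univ i))

end PointLip

/-! ### Charts -/

section Charts

variable {X : Type*} [PseudoMetricSpace X] [MeasurableSpace X] {μ : Measure X} {m : ℕ}

lemma derivVec_sub_inner_ae (d : Fin m → MetricDerivation μ) {η : Fin m → X → ℝ}
    (hη : ∀ i, IsLip (η i)) {f h : X → ℝ} (hf : IsLip f) (hh : IsLip h)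
    (v : EuclideanSpace ℝ (Fin m))
    (hfh : ∀ y, h y = f y - inner ℝ v (WithLp.toLp 2 fun i => η i y)) :
    ∀ᵐ x ∂μ, derivVec d h hh x = derivVec d f hf x - ∑ i, v i • derivVec d (η i) (hη i) x := by
  filter_upwards [ae_all_iff.2 fun j => (d j).ext_add_sum_ae hf hη hh (fun i => -v i)
    Finset.univ fun x => by
      rw [hfh, PiLp.inner_apply, sub_eq_add_neg, ← Finset.sum_neg_distrib]
      congr 1
      exact Finset.sum_congr rfl fun i _ => by simp [mul_comm]] with x hx
  ext j
  simp [derivVec, hx j, sub_eq_add_neg]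

/-- The Lip-derivation inequality holds simultaneously for all affine perturbations
of a Lipschitz function by the coordinates. -/
lemma LipDerivIneq.ae_forall_sub_inner {d : Fin m → MetricDerivation μ} {K : ℝ}
    (hd : LipDerivIneq d K) {η : Fin m → X → ℝ} (hη : ∀ i, IsLip (η i)) {f : X → ℝ}
    (hf : IsLip f) : ∀ᵐ x ∂μ, ∀ v : EuclideanSpace ℝ (Fin m),
      ENNReal.ofReal (K⁻¹ * ‖derivVec d f hf x - ∑ i, v i • derivVec d (η i) (hη i) x‖) ≤
        pointLip (fun y => f y - inner ℝ v (WithLp.toLp 2 fun i => η i y)) x ∧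
      pointLip (fun y => f y - inner ℝ v (WithLp.toLp 2 fun i => η i y)) x ≤
        ENNReal.ofReal (K * ‖derivVec d f hf x - ∑ i, v i • derivVec d (η i) (hη i) x‖) := by
  obtain ⟨L, hL⟩ := isLip_toLp hη
  have hinner : ∀ v : EuclideanSpace ℝ (Fin m),
      LipschitzWith (‖v‖₊ * L) fun y => (inner ℝ v (WithLp.toLp 2 fun i => η i y) : ℝ) := fun v => by
    refine LipschitzWith.of_dist_le_mul fun y z => ?_
    rw [Real.dist_eq, ← inner_sub_right]
    refine (abs_real_inner_le_norm _ _).trans ?_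
    rw [NNReal.coe_mul, coe_nnnorm, mul_assoc, ← dist_eq_norm]
    exact mul_le_mul_of_nonneg_left (hL.dist_le_mul y z) (norm_nonneg _)
  obtain ⟨L', hL'⟩ := id hf
  have hlip : ∀ v : EuclideanSpace ℝ (Fin m),
      IsLip fun y => f y - inner ℝ v (WithLp.toLp 2 fun i => η i y) := fun v =>
    ⟨_, hL'.sub (hinner v)⟩
  let q := TopologicalSpace.denseSeq (EuclideanSpace ℝ (Fin m))
  filter_upwards [ae_all_iff.2 fun n => hd _ (hlip (q n)),
    ae_all_iff.2 fun n => derivVec_sub_inner_ae d hη hf (hlip (q n)) (q n) fun _ => rfl]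
    with x hx₁ hx₂ v
  obtain ⟨w, hw, hwv⟩ := mem_closure_iff_seq_limit.1
    (TopologicalSpace.denseRange_denseSeq (EuclideanSpace ℝ (Fin m)) v)
  choose k hk using hw
  set T : EuclideanSpace ℝ (Fin m) → EuclideanSpace ℝ (Fin m) := fun v =>
    derivVec d f hf x - ∑ i, v i • derivVec d (η i) (hη i) x with hT
  set P : EuclideanSpace ℝ (Fin m) → ℝ≥0∞ := fun v =>
    pointLip (fun y => f y - inner ℝ v (WithLp.toLp 2 fun i => η i y)) x with hP
  have hTc : Continuous T := by fun_prop
  have hTw : ∀ n, ENNReal.ofReal (K⁻¹ * ‖T (w n)‖) ≤ P (w n) ∧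
      P (w n) ≤ ENNReal.ofReal (K * ‖T (w n)‖) := fun n => by
    have h₁ := hx₁ (k n)
    rw [hx₂ (k n)] at h₁
    rw [← hk n]
    exact h₁
  have hPP : ∀ v w, P v ≤ P w + (‖w - v‖₊ * L : ℝ≥0) := fun v w =>
    pointLip_le_add (hinner (w - v)) (fun y => by rw [inner_sub_left]; ring) x
  have hz₁ : Tendsto (fun n => ((‖w n - v‖₊ * L : ℝ≥0) : ℝ≥0∞)) atTop (𝓝 0) := by
    have h : Tendsto (fun n => ‖w n - v‖₊ * L) atTop (𝓝 (‖v - v‖₊ * L)) :=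
      ((hwv.sub_const v).nnnorm).mul_const L
    rw [sub_self, nnnorm_zero, zero_mul] at h
    exact ENNReal.tendsto_coe.2 h
  have hz₂ : Tendsto (fun n => ((‖v - w n‖₊ * L : ℝ≥0) : ℝ≥0∞)) atTop (𝓝 0) := by
    refine hz₁.congr fun n => ?_
    rw [← nnnorm_neg, neg_sub]
  have hTlim : ∀ a : ℝ, Tendsto (fun n => ENNReal.ofReal (a * ‖T (w n)‖)) atTop
      (𝓝 (ENNReal.ofReal (a * ‖T v‖))) := fun a =>
    ENNReal.tendsto_ofReal ((((hTc.tendsto v).comp hwv).norm).const_mul a)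
  constructor
  · have h := (tendsto_const_nhds (x := P v)).add hz₂
    rw [add_zero] at h
    exact le_of_tendsto_of_tendsto' (hTlim K⁻¹) h fun n => (hTw n).1.trans (hPP _ _)
  · have h := (hTlim K).add hz₁
    rw [add_zero] at h
    exact ge_of_tendsto' h fun n => (hPP v (w n)).trans (add_le_add_left (hTw n).2 _)

/-- Operator boundedness alone is not enough, since the norms of the truncations of an unbounded `f`
grow with the height; the lower Lip-derivation bound only sees the Lipschitz constant. -/
lemma LipDerivIneq.norm_derivVec_le_ae {d : Fin m → MetricDerivation μ} {K : ℝ}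
    (hd : LipDerivIneq d K) (hK : 0 < K) {f : X → ℝ} (hf : IsLip f) :
    ∃ C : ℝ, ∀ᵐ x ∂μ, ‖derivVec d f hf x‖ ≤ C := by
  obtain ⟨L, hL⟩ := id hf
  refine ⟨K * L, ?_⟩
  filter_upwards [hd f hf] with x hx
  have h := hx.1.trans (pointLip_le hL x)
  rw [← ENNReal.ofReal_coe_nnreal, ENNReal.ofReal_le_ofReal_iff L.coe_nonneg] at h
  rwa [inv_mul_le_iff₀ hK] at h

/-- The matrix of derivatives of the functions `η i`. -/
noncomputable def derivMatrix (d : Fin m → MetricDerivation μ) {η : Fin m → X → ℝ}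
    (hη : ∀ i, IsLip (η i)) (x : X) : Matrix (Fin m) (Fin m) ℝ :=
  Matrix.of fun i j => (d j).ext (η i) (hη i) x

/-- The left side is the linear system `df = v A` for the row vector `v`, with `A` invertible. -/
lemma derivVec_sub_sum_eq_zero_iff (d : Fin m → MetricDerivation μ) {η : Fin m → X → ℝ}
    (hη : ∀ i, IsLip (η i)) {f : X → ℝ} (hf : IsLip f) {x : X}
    (hx : (derivMatrix d hη x).det ≠ 0) (v : EuclideanSpace ℝ (Fin m)) :
    derivVec d f hf x - ∑ i, v i • derivVec d (η i) (hη i) x = 0 ↔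
      v = WithLp.toLp 2 (Matrix.vecMul (fun j => (d j).ext f hf x) (derivMatrix d hη x)⁻¹) := by
  have h : derivVec d f hf x - ∑ i, v i • derivVec d (η i) (hη i) x = 0 ↔
      (fun j => (d j).ext f hf x) = Matrix.vecMul v.ofLp (derivMatrix d hη x) := by
    rw [sub_eq_zero]
    constructor
    · intro h
      funext j
      simpa [derivVec, derivMatrix, Matrix.vecMul, dotProduct] using congrArg (fun u => u j) h
    · intro h
      ext j
      simpa [derivVec, derivMatrix, Matrix.vecMul, dotProduct] using congrFun h j
  have hu : IsUnit (derivMatrix d hη x).det := isUnit_iff_ne_zero.2 hx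
  rw [h]
  constructor
  · intro h
    rw [h, Matrix.vecMul_vecMul, Matrix.mul_nonsing_inv _ hu, Matrix.vecMul_one]
  · intro h
    rw [h, Matrix.vecMul_vecMul, Matrix.nonsing_inv_mul _ hu, Matrix.vecMul_one]

variable [OpensMeasurableSpace X]

lemma measurable_det_derivMatrix (d : Fin m → MetricDerivation μ) {η : Fin m → X → ℝ}
    (hη : ∀ i, IsLip (η i)) : Measurable fun x => (derivMatrix d hη x).det := by
  have h : ∀ i j, Measurable ((d j).ext (η i) (hη i)) := fun i j => (d j).measurable_ext _
  simp only [Matrix.det_apply, derivMatrix, Matrix.of_apply]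
  fun_prop

lemma measurable_inv_derivMatrix (d : Fin m → MetricDerivation μ) {η : Fin m → X → ℝ}
    (hη : ∀ i, IsLip (η i)) (i j : Fin m) :
    Measurable fun x => (derivMatrix d hη x)⁻¹ i j := by
  have h : ∀ i j, Measurable ((d j).ext (η i) (hη i)) := fun i j => (d j).measurable_ext _
  simp only [Matrix.inv_def, Matrix.smul_apply, smul_eq_mul, Ring.inverse_eq_inv']
  refine (measurable_det_derivMatrix d hη).inv.mul ?_
  simp only [Matrix.adjugate_apply, Matrix.det_apply]
  refine Finset.measurable_fun_sum _ fun σ _ => Measurable.const_smul ?_ _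
  refine Finset.measurable_fun_prod _ fun k _ => ?_
  by_cases hk : σ k = j
  · simp only [Matrix.updateRow_apply, hk, if_true]
    exact measurable_const
  · simp only [Matrix.updateRow_apply, hk, if_false]
    exact h _ _

/-- On a set where the matrix of derivatives of `η` is invertible with bounded inverse,
the functions `η i` are coordinates of a chart. -/
lemma LipDerivIneq.isDiffChart {d : Fin m → MetricDerivation μ} {K : ℝ}
    (hd : LipDerivIneq d K) (hK : 0 < K) {η : Fin m → X → ℝ} (hη : ∀ i, IsLip (η i))
    {Y : Set X} (hY : MeasurableSet Y) (hYpos : μ Y ≠ 0)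
    (hdet : ∀ x ∈ Y, (derivMatrix d hη x).det ≠ 0) {C : ℝ}
    (hC : ∀ x ∈ Y, ∀ i j, |(derivMatrix d hη x)⁻¹ i j| ≤ C) :
    IsDiffChart μ Y m fun y => WithLp.toLp 2 fun i => η i y where
  measurable := hY.nullMeasurableSet
  pos := pos_iff_ne_zero.2 hYpos
  lip := isLip_toLp hη
  differential f hf := by
    set Df : X → EuclideanSpace ℝ (Fin m) := fun x =>
      WithLp.toLp 2 (Matrix.vecMul (fun j => (d j).ext f hf x) (derivMatrix d hη x)⁻¹) with hDf
    have hmem : MemLp Df ∞ (μ.restrict Y) := by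
      obtain ⟨B, hB⟩ := hd.norm_derivVec_le_ae hK hf
      refine MemLp.of_eval_piLp fun i => ?_
      have hsum : (fun x => Df x i) =
          fun x => ∑ j, (d j).ext f hf x * (derivMatrix d hη x)⁻¹ j i := by
        funext x
        simp [hDf, Matrix.vecMul, dotProduct]
      rw [hsum]
      refine memLp_finsetSum _ fun j _ => MemLp.mul (r := ∞) (p := ∞) (q := ∞) ?_ ?_
      · refine memLp_top_of_bound (measurable_inv_derivMatrix d hη j i).aestronglyMeasurable C ?_
        exact (ae_restrict_iff' hY).2 (ae_of_all _ fun x hx => hC x hx j i)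
      · refine memLp_top_of_bound ((d j).measurable_ext hf).aestronglyMeasurable B ?_
        refine ae_restrict_of_ae ?_
        filter_upwards [hB] with x hx
        exact (PiLp.norm_apply_le (derivVec d f hf x) j).trans hx
    -- The inequality is used at `v = Df x` and `v = D x`, which vary with `x`, hence the version
    -- uniform in `v`.
    have hall := ae_restrict_of_ae (s := Y) (hd.ae_forall_sub_inner hη hf)
    have hYae : ∀ᵐ x ∂μ.restrict Y, x ∈ Y := ae_restrict_mem hY
    refine ⟨hmem.toLp, ?_, fun D hD => ?_⟩
    · filter_upwards [hall, hYae, hmem.coeFn_toLp] with x hx hxY hxD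
      rw [hxD]
      have h0 := (derivVec_sub_sum_eq_zero_iff d hη hf (hdet x hxY) (Df x)).2 rfl
      have h := (hx (Df x)).2
      rw [h0, norm_zero, mul_zero, ENNReal.ofReal_zero] at h
      exact nonpos_iff_eq_zero.1 h
    · refine Lp.ext ?_
      filter_upwards [hall, hYae, hmem.coeFn_toLp, hD] with x hx hxY hxD hxD'
      rw [hxD]
      refine (derivVec_sub_sum_eq_zero_iff d hη hf (hdet x hxY) (D x)).1 ?_
      have h := (hx (D x)).1
      rw [hxD', nonpos_iff_eq_zero, ENNReal.ofReal_eq_zero] at h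
      have h2 : ‖derivVec d f hf x - ∑ i, D x i • derivVec d (η i) (hη i) x‖ ≤ 0 := by
        have h3 := (inv_pos.2 hK)
        by_contra! h4
        exact absurd h (not_le.2 (mul_pos h3 h4))
      exact norm_le_zero_iff.1 h2

end Charts

/-! ### The main theorem -/

/-- Points are compact, so outer regularity gives them neighbourhoods of finite measure. With second
countability this yields σ-finiteness. -/
lemma MeasureTheory.Measure.Regular.isLocallyFiniteMeasure {X : Type*} [TopologicalSpace X]
    [T1Space X] [MeasurableSpace X] [BorelSpace X] {μ : Measure X} (hμ : μ.Regular) :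
    IsLocallyFiniteMeasure μ where
  finiteAtNhds x := by
    obtain ⟨U, hxU, hU, hlt⟩ := Set.exists_isOpen_lt_of_lt {x} ∞
      (isCompact_singleton.measure_lt_top (μ := μ))
    exact ⟨U, hU.mem_nhds (hxU rfl), hlt⟩

/-- For `μ = 0` all coefficients are zero in `L^∞`, so `m + 1` copies of one derivation would be
independent. -/
lemma IsDerivBasis.measure_ne_zero {X : Type*} [PseudoMetricSpace X] [MeasurableSpace X]
    {μ : Measure X} {m : ℕ} (hm : 0 < m) {d : Fin m → MetricDerivation μ} (hd : IsDerivBasis d) :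
    μ ≠ 0 := by
  rintro rfl
  refine hd.2.2 (fun _ => d ⟨0, hm⟩) fun c _ i => Lp.ext ?_
  simp [EventuallyEq]

theorem mainTheorem4 {X : Type*} [MetricSpace X] [TopologicalSpace.SeparableSpace X]
    [MeasurableSpace X] [BorelSpace X] (μ : Measure X) (hμ : μ.Regular)
    (hleb : LebesgueDiffProp μ)
    (M : ℕ) (hM : 0 < M) (d : Fin M → MetricDerivation μ) (hd : IsDerivBasis d)
    (N : ℕ) (hMN : M ≤ N) (g : Fin N → X → ℝ) (hg : Generates g)
    (K : ℝ) (hK : 1 ≤ K) (hlip : LipDerivIneq d K) :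
    ∃ S : MeasurableDiffStructure μ, S.Nondegenerate := by
  have hK0 : 0 < K := one_pos.trans_le hK
  have hlf := hμ.isLocallyFiniteMeasure
  have : SecondCountableTopology X := UniformSpace.secondCountable_of_separable X
  have hη : ∀ (I : Fin M → Fin N) i, IsLip (g (I i)) := fun I i => hg.1 (I i)
  let Y : (Fin M → Fin N) × ℕ → Set X := fun p =>
    {x | (derivMatrix d (hη p.1) x).det ≠ 0 ∧ ∀ i j, |(derivMatrix d (hη p.1) x)⁻¹ i j| ≤ p.2}
  have hYm : ∀ p, MeasurableSet (Y p) := fun p => by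
    refine MeasurableSet.inter
      ((measurable_det_derivMatrix d (hη p.1)) (measurableSet_singleton 0).compl) ?_
    have h : {x | ∀ i j, |(derivMatrix d (hη p.1) x)⁻¹ i j| ≤ p.2} =
        ⋂ i, ⋂ j, {x | |(derivMatrix d (hη p.1) x)⁻¹ i j| ≤ p.2} := by
      ext x; simp
    change MeasurableSet {x | ∀ i j, |(derivMatrix d (hη p.1) x)⁻¹ i j| ≤ p.2}
    rw [h]
    refine MeasurableSet.iInter fun i => MeasurableSet.iInter fun j =>
      measurableSet_le (measurable_inv_derivMatrix d (hη p.1) i j).abs measurable_const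
  have hcover : ∀ᵐ x ∂μ, ∃ p, x ∈ Y p := by
    filter_upwards [hd.1.ae_exists_det_ne_zero hg] with x hx
    obtain ⟨I, hI⟩ := hx
    obtain ⟨n, hn⟩ := exists_nat_gt (∑ i, ∑ j, |(derivMatrix d (hη I) x)⁻¹ i j|)
    refine ⟨(I, n), hI, fun i j => le_trans ?_ hn.le⟩
    refine le_trans ?_ (Finset.single_le_sum
      (f := fun i => ∑ j, |(derivMatrix d (hη I) x)⁻¹ i j|) (fun _ _ => by positivity)
      (Finset.mem_univ i))
    exact Finset.single_le_sum (f := fun j => |(derivMatrix d (hη I) x)⁻¹ i j|)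
      (fun _ _ => abs_nonneg _) (Finset.mem_univ j)
  have hex : ∃ p, μ (Y p) ≠ 0 := by
    by_contra! h
    have h0 : ∀ᵐ x ∂μ, ∀ p, x ∉ Y p :=
      ae_all_iff.2 fun p => measure_eq_zero_iff_ae_notMem.1 (h p)
    have hfalse : ∀ᵐ x ∂μ, False := by
      filter_upwards [h0, hcover] with x h₁ ⟨p, hp⟩ using h₁ p hp
    exact hd.measure_ne_zero hM (ae_eq_bot.1 (eventually_false_iff_eq_bot.1 hfalse))
  obtain ⟨p₀, hp₀⟩ := hex
  have : Nonempty ((Fin M → Fin N) × ℕ) := ⟨p₀⟩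
  obtain ⟨e, he⟩ := exists_surjective_nat ((Fin M → Fin N) × ℕ)
  classical
  -- A chart must have positive measure, so null pieces are replaced by the fixed non-null piece `Y
  -- p₀`; the part lost is a countable union of null sets.
  let e' : ℕ → (Fin M → Fin N) × ℕ := fun k => if μ (Y (e k)) = 0 then p₀ else e k
  have he' : ∀ k, μ (Y (e' k)) ≠ 0 := fun k => by
    by_cases h : μ (Y (e k)) = 0
    · simpa only [e', if_pos h] using hp₀
    · simpa only [e', if_neg h] using h
  refine ⟨{ chart := fun k => Y (e' k)
            dim := fun _ => M
            coord := fun k y => WithLp.toLp 2 fun i => g ((e' k).1 i) y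
            isChart := fun k => hlip.isDiffChart hK0 (hη (e' k).1) (hYm _) (he' k)
              (fun x hx => hx.1) (fun x hx => hx.2)
            cover := ?_
            dimBound := ⟨M, fun _ => le_rfl⟩ }, 0, hM⟩
  have hnull : ∀ᵐ x ∂μ, ∀ p, μ (Y p) = 0 → x ∉ Y p :=
    by
    refine ae_all_iff.2 fun p => ?_
    by_cases h : μ (Y p) = 0
    · filter_upwards [measure_eq_zero_iff_ae_notMem.1 h] with x hx _ using hx
    · exact ae_of_all _ fun x h' => absurd h' h
  refine measure_eq_zero_iff_ae_notMem.2 ?_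
  filter_upwards [hcover, hnull] with x ⟨p, hp⟩ hx hxc
  obtain ⟨k, rfl⟩ := he p
  refine hxc (mem_iUnion.2 ⟨k, ?_⟩)
  have hne : μ (Y (e k)) ≠ 0 := fun h => hx _ h hp
  simpa only [e', if_neg hne] using hp
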